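/- Let $d,q\in\mathbb N$, let $U\subseteq\mathbb R^d$ be a domain (more generally, any Borel measurable set), and let $(\Omega,\mathcal F,\mathbb P)$ be a probability space, complete or not. Let $L^2(U;\mathbb R^q)$ be the real Hilbert space of square integrable vector fields on $U$ with inner product $(\mathbf u,\mathbf v)=\int_U \mathbf u^{\rm T}\mathbf v\,dx$, let $L^2_{\mathbb P}(\Omega)$ be the real Hilbert space of square integrable random variables, and let $L^2_{\mathbb P}(\Omega;L^2(U;\mathbb R^q))$ be the Bochner space of (classes of) strongly measurable, square integrable maps $\Omega\to L^2(U;\mathbb R^q)$, with inner product $\int_\Omega(\mathbf u(\omega),\mathbf v(\omega))\,d\mathbb P(\omega)$. Let $L^2(U;\mathbb R^q)\otimes L^2_{\mathbb P}(\Omega)$ denote the Hilbert tensor product, i.e. the completion of the algebraic tensor product over $\mathbb R$ with respect to the inner product determined by $(\mathbf v\otimes s,\mathbf v'\otimes s')=(\mathbf v,\mathbf v')\,(s,s')$. Then there is a surjective linear isometry $$\Phi: L^2(U;\mathbb R^q)\otimes L^2_{\mathbb P}(\Omega)\longrightarrow L^2_{\mathbb P}(\Omega;L^2(U;\mathbb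 R^q))$$ such that, for all $\mathbf v\in L^2(U;\mathbb R^q)$ and $s\in L^2_{\mathbb P}(\Omega)$, $\Phi(\mathbf v\otimes s)(\omega)=s(\omega)\,\mathbf v$ for $\mathbb P$-almost every $\omega$. In particular, the two Hilbert spaces are isometrically isomorphic. -/

import Mathlib

open MeasureTheory
open scoped TensorProduct

/-- The real Hilbert space `L²(U; ℝ^q)` of (classes of) square integrable vector fields on
`U ⊆ ℝ^d`, for Lebesgue measure, with inner product `(u, v) = ∫_U uᵀ v dx`. -/
abbrev L2Field {d : ℕ} (U : Set (EuclideanSpace ℝ (Fin d))) (q : ℕ) : Type :=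
  Lp (EuclideanSpace ℝ (Fin q)) 2 (volume.restrict U)

/-- The Hilbert tensor product of two real inner product spaces: the completion of the algebraic
tensor product for the inner product with `⟪a ⊗ b, a' ⊗ b'⟫ = ⟪a, a'⟫ * ⟪b, b'⟫`. -/
abbrev HilbertTensor (H S : Type*) [NormedAddCommGroup H] [InnerProductSpace ℝ H]
    [NormedAddCommGroup S] [InnerProductSpace ℝ S] : Type _ :=
  UniformSpace.Completion (H ⊗[ℝ] S)

/-- The elementary tensor `a ⊗ b` as an element of the Hilbert tensor product. -/
noncomputable def HilbertTensor.tmul {H S : Type*} [NormedAddCommGroup H] [InnerProductSpace ℝ H]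
    [NormedAddCommGroup S] [InnerProductSpace ℝ S] (a : H) (b : S) : HilbertTensor H S :=
  ((a ⊗ₜ[ℝ] b : H ⊗[ℝ] S) : UniformSpace.Completion (H ⊗[ℝ] S))

namespace MeasureTheory.L2

variable {Ω H : Type*} [MeasurableSpace Ω] {μ : Measure Ω}
  [NormedAddCommGroup H] [InnerProductSpace ℝ H]

/-! The map `v ⊗ s ↦ s(·) v` preserves inner products of elementary tensors, hence of all tensors by
bilinearity. Its range contains every `1_A c`, so it is dense, and a linear isometry with dense
range into a complete space extends to a surjective isometry from the completion. -/

/-- The bilinear map `(v, s) ↦ s(·) v` into the Bochner space of `H`-valued functions,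
as a linear map on the algebraic tensor product. -/
noncomputable def ofTensor (μ : Measure Ω) (H : Type*) [NormedAddCommGroup H]
    [InnerProductSpace ℝ H] : H ⊗[ℝ] Lp ℝ 2 μ →ₗ[ℝ] Lp H 2 μ :=
  TensorProduct.lift ((ContinuousLinearMap.lsmul ℝ ℝ).flip.compLpₗ₂ 2 μ)

theorem coeFn_ofTensor_tmul (v : H) (s : Lp ℝ 2 μ) :
    ofTensor μ H (v ⊗ₜ[ℝ] s) =ᵐ[μ] fun ω => s ω • v :=
  ContinuousLinearMap.coeFn_compLp ((ContinuousLinearMap.lsmul ℝ ℝ).flip v) s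

theorem inner_ofTensor_tmul (v w : H) (s t : Lp ℝ 2 μ) :
    inner ℝ (ofTensor μ H (v ⊗ₜ[ℝ] s)) (ofTensor μ H (w ⊗ₜ[ℝ] t)) =
      inner ℝ v w * inner ℝ s t := by
  rw [L2.inner_def, L2.inner_def, ← integral_const_mul]
  refine integral_congr_ae ?_
  filter_upwards [coeFn_ofTensor_tmul v s, coeFn_ofTensor_tmul w t] with ω hv hw
  rw [hv, hw, real_inner_smul_left, real_inner_smul_right, Real.inner_apply]
  ring

theorem inner_ofTensor (x y : H ⊗[ℝ] Lp ℝ 2 μ) :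
    inner ℝ (ofTensor μ H x) (ofTensor μ H y) = inner ℝ x y := by
  induction x with
  | zero => simp
  | add a b ha hb => rw [map_add, inner_add_left, inner_add_left, ha, hb]
  | tmul v s =>
    induction y with
    | zero => simp
    | add a b ha hb => rw [map_add, inner_add_right, inner_add_right, ha, hb]
    | tmul w t => rw [inner_ofTensor_tmul, TensorProduct.inner_tmul]

theorem norm_ofTensor (x : H ⊗[ℝ] Lp ℝ 2 μ) : ‖ofTensor μ H x‖ = ‖x‖ :=
  ((ofTensor μ H).isometryOfInner inner_ofTensor).norm_map x

theorem denseRange_ofTensor : DenseRange (ofTensor μ H) := by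
  intro f
  induction f using Lp.induction (ENNReal.ofNat_ne_top : (2 : ENNReal) ≠ ⊤) with
  | indicatorConst c hs hμs =>
    refine subset_closure ⟨c ⊗ₜ indicatorConstLp 2 hs hμs.ne (1 : ℝ), ?_⟩
    exact (indicatorConstLp_eq_toSpanSingleton_compLp hs hμs.ne c).symm
  | add hf hg _ ihf ihg =>
    -- The closure of a linear range is a submodule, hence stable under sums.
    exact (LinearMap.range (ofTensor μ H)).topologicalClosure.add_mem ihf ihg
  | isClosed => exact isClosed_closure

/-- The Hilbert tensor product `H ⊗ L²(μ)` is isometrically isomorphic to the Bochner space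
`L²(μ; H)`. -/
noncomputable def hilbertTensorEquiv (μ : Measure Ω) (H : Type*) [NormedAddCommGroup H]
    [InnerProductSpace ℝ H] [CompleteSpace H] :
    HilbertTensor H (Lp ℝ 2 μ) ≃ₗᵢ[ℝ] Lp H 2 μ :=
  -- Two dense-range maps out of the algebraic tensor product, with equal norms, so the identity
  -- extends to their complete targets.
  (LinearEquiv.refl ℝ (H ⊗[ℝ] Lp ℝ 2 μ)).extendOfIsometry
    (UniformSpace.Completion.toComplₗᵢ (𝕜 := ℝ)).toLinearMap (ofTensor μ H)
    UniformSpace.Completion.denseRange_coe denseRange_ofTensor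
    fun x => (norm_ofTensor x).trans (UniformSpace.Completion.norm_coe x).symm

theorem hilbertTensorEquiv_tmul [CompleteSpace H] (v : H) (s : Lp ℝ 2 μ) :
    hilbertTensorEquiv μ H (HilbertTensor.tmul v s) = ofTensor μ H (v ⊗ₜ[ℝ] s) :=
  LinearEquiv.extendOfIsometry_eq (LinearEquiv.refl ℝ (H ⊗[ℝ] Lp ℝ 2 μ))
    (UniformSpace.Completion.toComplₗᵢ (𝕜 := ℝ)).toLinearMap (ofTensor μ H) _ _ _ (v ⊗ₜ[ℝ] s)

end MeasureTheory.L2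

theorem proposition3 {d q : ℕ} (U : Set (EuclideanSpace ℝ (Fin d))) (hU : MeasurableSet U)
    {Ω : Type*} [MeasurableSpace Ω] (P : Measure Ω) [IsProbabilityMeasure P] :
    ∃ Φ : HilbertTensor (L2Field U q) (Lp ℝ 2 P) ≃ₗᵢ[ℝ] Lp (L2Field U q) 2 P,
      ∀ (v : L2Field U q) (s : Lp ℝ 2 P),
        (Φ (HilbertTensor.tmul v s) : Ω → L2Field U q) =ᵐ[P] fun ω => s ω • v := by
  refine ⟨L2.hilbertTensorEquiv P (L2Field U q), fun v s => ?_⟩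
  rw [L2.hilbertTensorEquiv_tmul]
  exact L2.coeFn_ofTensor_tmul v s
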